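/- Let $I=[0,1]$ or $I=[0,\infty)$, and let $\Pr$ be Wiener measure on the space $C(I)$ of continuous functions $I\to\mathbb R$ (with the topology of uniform convergence on compact sets), i.e. the law of standard one-dimensional Brownian motion started at $0$. For a piecewise linear function $p$ that interpolates between finitely many points with rational coordinates, a rational $r>0$ and an integer $N\ge 1$, let $O_{p,r,N}=\{f\in C(I) : |f(t)-p(t)|<r \text{ for all } t\in I\cap[0,N]\}$ (for $I=[0,1]$ these are the sup-norm balls $\|f-p\|_\infty<r$). A Martin-Löf test is a sequence $(\mathcal U_n)_{n\ge 0}$ of subsets of $C(I)$, each a union of sets $O_{p,r,N}$ whose codes are recursively enumerable uniformly in $n$, with $\Pr(\mathcal U_n)\le 2^{-n}$ for all $n$. A path $B\in C(I)$ is Martin-Löf random if $B\notin\bigcap_n\mathcal U_n$ for every Martin-Löf test $(\mathcal U_n)_n$. Let $K$ denote prefix-free Kolmogorov complexity of finite binary strings (with respect to any fixed optimal prefix-free machine). The effective Hausdorff dimension of an infinite binary sequence $X$ is $$\mathrm{cdim}(X)=\liminf_{n\to\infty}\frac{K(X\upharpoonright n)}{n},$$ and the effective Hausdorff dimension $\mathrm{cdim}(x)$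 of a real $x\ge 0$ is that of the sequence of binary digits of its fractional part. Theorem. If $B$ is a Martin-Löf random path and $Z_B=\{t\in I : B(t)=0\}$ is its zero set, then $\mathrm{cdim}(t)\ge \tfrac12$ for every $t\in Z_B\setminus\{0\}$. -/

import Mathlib

open MeasureTheory ProbabilityTheory Filter
open scoped NNReal ENNReal

noncomputable section

namespace MLBrownian

/-! ### Path space and Wiener measure -/

/-- Spaces of continuous real functions carry the Borel `σ`-algebra of the topology of uniform
convergence on compact sets (the sup-norm topology when the domain is compact). -/
instance pathMeasurableSpace {X : Type*} [TopologicalSpace X] : MeasurableSpace C(X, ℝ) :=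
  borel _

instance pathBorelSpace {X : Type*} [TopologicalSpace X] : BorelSpace C(X, ℝ) :=
  ⟨rfl⟩

/-- Wiener measure on `C(I, ℝ)`: the law of standard Brownian motion with time set `I`. Under `μ`
the coordinate process starts at `0`, has independent increments, and `f t - f s` is normal with
mean `0` and variance `t - s` whenever `s ≤ t`. -/
structure IsWienerMeasure {I : Set ℝ≥0} (μ : Measure C(I, ℝ)) : Prop where
  isProbabilityMeasure : IsProbabilityMeasure μ
  eval_zero : ∀ t : I, (t : ℝ≥0) = 0 → ∀ᵐ f ∂μ, f t = 0
  indep_increments : HasIndepIncrements (fun (t : I) (f : C(I, ℝ)) => f t) μ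
  law_increment : ∀ s t : I, s ≤ t →
    HasLaw (fun f : C(I, ℝ) => f t - f s) (gaussianReal 0 ((t : ℝ≥0) - (s : ℝ≥0))) μ

/-! ### Effectively open sets and Martin-Löf randomness -/

/-- The piecewise linear function whose graph interpolates between the points
`(k / (m + 1), v k / (d + 1))`, `k = 0, 1, …`, where `v k = 0` once `k` exceeds the length of the
list `v`. As `m`, `d` and `v` vary, the restrictions to `[0, N]` of these functions are exactly the
piecewise linear functions on `[0, N]` interpolating between finitely many points with rational
coordinates. -/
def interpolant (m d : ℕ) (v : List ℤ) (t : ℝ) : ℝ :=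
  ∑ k : Fin v.length, ((v.get k : ℝ) / ((d : ℝ) + 1)) * max 0 (1 - |((m : ℝ) + 1) * t - (k : ℕ)|)

/-- Finite codes `(N, m, d, j, v)` for basic open sets of paths. -/
abbrev BallCode : Type := ℕ × ℕ × ℕ × ℕ × List ℤ

/-- The basic open set coded by `(N, m, d, j, v)`: all paths whose distance from the rational
piecewise linear function `interpolant m d v` is less than the rational number
`(j + 1) / (d + 1)`, uniformly on `I ∩ [0, N + 1]`.
For `I = [0, 1]` these are exactly the sup-norm balls of positive rational radius around rational
piecewise linear functions; for `I = [0, ∞)` they are the balls for the sup-seminorms on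
`[0, N + 1]`. -/
def basicOpen (I : Set ℝ≥0) : BallCode → Set C(I, ℝ)
  | (N, m, d, j, v) =>
    {f | ∀ t : I, (t : ℝ≥0) ≤ (N : ℝ≥0) + 1 →
      |f t - interpolant m d v ((t : ℝ≥0) : ℝ)| < ((j : ℝ) + 1) / ((d : ℝ) + 1)}

/-- A sequence of sets of paths that is uniformly effectively open (uniformly `Σ⁰₁`): the `n`-th
set is the union of the basic open sets whose codes `c` satisfy `W (n, c)`, for a single
recursively enumerable relation `W`. -/
def UniformlyEffectivelyOpen {I : Set ℝ≥0} (U : ℕ → Set C(I, ℝ)) : Prop :=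
  ∃ W : ℕ × BallCode → Prop, REPred W ∧
    ∀ n, U n = {f | ∃ c : BallCode, W (n, c) ∧ f ∈ basicOpen I c}

/-- Martin-Löf tests with respect to the measure `μ`. -/
structure IsMLTest {I : Set ℝ≥0} (μ : Measure C(I, ℝ)) (U : ℕ → Set C(I, ℝ)) : Prop where
  effectivelyOpen : UniformlyEffectivelyOpen U
  measure_le : ∀ n, μ (U n) ≤ (2⁻¹ : ℝ≥0∞) ^ n

/-- A path is Martin-Löf random for `μ` if no Martin-Löf test captures it. -/
def IsMLRandom {I : Set ℝ≥0} (μ : Measure C(I, ℝ)) (B : C(I, ℝ)) : Prop :=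
  ∀ U : ℕ → Set C(I, ℝ), IsMLTest μ U → B ∉ ⋂ n, U n

/-- The zero set `{t : B t = 0}` of a path. -/
def zeroSet {I : Set ℝ≥0} (B : C(I, ℝ)) : Set ℝ≥0 :=
  {t | ∃ h : t ∈ I, B ⟨t, h⟩ = 0}

/-! ### Prefix-free complexity and effective Hausdorff dimension -/

/-- A prefix-free machine: a partial computable function on finite binary strings such that no
string in its domain is a proper prefix of another string in its domain. -/
structure IsPrefixFreeMachine (M : List Bool →. List Bool) : Prop where
  partrec : Partrec M
  prefixFree : ∀ σ τ : List Bool, (M σ).Dom → (M τ).Dom → σ <+: τ → σ = τ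

/-- The length of a shortest `M`-program for `σ` (and `⊤` if there is none). -/
def complexity (M : List Bool →. List Bool) (σ : List Bool) : ℕ∞ :=
  ⨅ (p : List Bool) (_ : σ ∈ M p), (p.length : ℕ∞)

/-- Optimal prefix-free machines, that is, the reference machines `U` for which prefix-free
Kolmogorov complexity is `K = complexity U`. -/
structure IsOptimalPrefixFreeMachine (U : List Bool →. List Bool) : Prop
    extends IsPrefixFreeMachine U where
  optimal : ∀ M : List Bool →. List Bool, IsPrefixFreeMachine M →
    ∃ c : ℕ, ∀ σ : List Bool, complexity U σ ≤ complexity M σ + c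

/-- The effective Hausdorff dimension `liminf K(X ↾ n) / n` of an infinite binary sequence, where
`K` is the complexity with respect to the reference machine `U`. -/
def seqEffDim (U : List Bool →. List Bool) (X : ℕ → Bool) : ℝ≥0∞ :=
  liminf (fun n : ℕ => (complexity U ((List.range n).map X) : ℝ≥0∞) / (n : ℝ≥0∞)) atTop

/-- The binary digits of `x` after the binary point: `binaryDigits x i` is the digit of
weight `2 ^ (-(i + 1))`. -/
def binaryDigits (x : ℝ) (i : ℕ) : Bool :=
  decide (⌊x * 2 ^ (i + 1)⌋ % 2 = 1)

/-- The effective Hausdorff dimension of a real number, identified with its binary representation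
(the finitely many digits in front of the binary point play no role). -/
def effDim (U : List Bool →. List Bool) (x : ℝ) : ℝ≥0∞ :=
  seqEffDim U (binaryDigits x)

end MLBrownian

end

/-!
Suppose that `B t = 0` with `t ≠ 0`, and fix `ρ` slightly above `2 ^ (-1/2)`. At level `n` of the
dyadic grid the increments of Brownian motion have standard deviation `2 ^ (-n/2)`, so by the
Gaussian tail bound it has probability at most `C * 2 ^ (-n)` that one of them exceeds `ρ ^ n`.
A random path avoids these effectively open events from some level on (an effective Borel–Cantelli
lemma), and summing the increments leading from the `n`-th dyadic approximation of `t` to `t` itself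
shows that `|B|` is at most a constant times `ρ ^ n` at this approximation.

If `cdim t < a < 1/2`, then infinitely many of these approximations lie in an effectively enumerable
set of at most `2 ^ (a * n + 1)` candidates. Away from the origin the density of `B s` is bounded,
hence the probability that `|B|` is below a multiple of `ρ ^ n` at some candidate is at most a
multiple of `(2 ^ a * ρ) ^ n`. Since `2 ^ a * ρ < 1` for `ρ` close enough to `2 ^ (-1/2)`, a random
path avoids these events as well from some level on, a contradiction.
-/

noncomputable section

namespace MLBrownian

/-! ### Recursively enumerable predicates -/

section RecursivelyEnumerable

variable {α β : Type*} [Primcodable α] [Primcodable β]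

theorem rePred_of_primrecPred {p : α → Prop} (hp : PrimrecPred p) : REPred p :=
  hp.computablePred.to_re

theorem rePred_comp {p : β → Prop} (hp : REPred p) {f : α → β} (hf : Computable f) :
    REPred fun a => p (f a) :=
  Partrec.comp hp hf

theorem rePred_and {p q : α → Prop} (hp : REPred p) (hq : REPred q) :
    REPred fun a => p a ∧ q a := by
  have hpq : Partrec fun a => (Part.assert (p a) fun _ => Part.some ()).bind
      fun _ => Part.assert (q a) fun _ => Part.some () :=
    Partrec.bind hp (rePred_comp hq Computable.fst)
  exact hpq.dom_re.of_eq fun a => by simp [Part.assert]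

theorem rePred_bind {f : α →. β} (hf : Partrec f) {p : α × β → Prop} (hp : REPred p) :
    REPred fun a => ∃ b ∈ f a, p (a, b) := by
  have hfp : Partrec fun a => (f a).bind fun b => Part.assert (p (a, b)) fun _ => Part.some () :=
    Partrec.bind hf hp
  exact hfp.dom_re.of_eq fun a => by simp [Part.dom_iff_mem]

theorem rePred_exists {p : α × β → Prop} (hp : REPred p) : REPred fun a => ∃ b, p (a, b) := by
  obtain ⟨c, hc⟩ := Nat.Partrec.Code.exists_code.1 hp
  have eval_dom (x : α × β) : p x ↔ ∃ k u, u ∈ c.evaln k (Encodable.encode x) := by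
    have : p x ↔ (c.eval (Encodable.encode x)).Dom := by rw [hc]; simp [Part.assert]
    rw [this, Part.dom_iff_mem, exists_comm]
    simp only [Nat.Partrec.Code.evaln_complete]
  -- Dovetailing: `n` codes a candidate witness together with a time bound.
  let search (a : α) (n : ℕ) : Option ℕ :=
    (Encodable.decode (α := β) n.unpair.1).bind fun b =>
      c.evaln n.unpair.2 (Encodable.encode (a, b))
  have hsearch : Computable₂ search := by
    have hdecode : Primrec fun x : α × ℕ => Encodable.decode (α := β) x.2.unpair.1 :=
      Primrec.decode.comp (Primrec.fst.comp (Primrec.unpair.comp Primrec.snd))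
    have hevaln : Primrec₂ fun (x : α × ℕ) (b : β) =>
        c.evaln x.2.unpair.2 (Encodable.encode (x.1, b)) :=
      Nat.Partrec.Code.primrec_evaln.comp
        (((Primrec.snd.comp (Primrec.unpair.comp (Primrec.snd.comp Primrec.fst))).pair
          (Primrec.const c)).pair
          (Primrec.encode.comp ((Primrec.fst.comp Primrec.fst).pair Primrec.snd)))
    exact (Primrec.option_bind hdecode hevaln).to_comp
  refine (Partrec.rfindOpt hsearch).dom_re.of_eq fun a => ?_
  rw [Nat.rfindOpt_dom]
  constructor
  · rintro ⟨n, u, hu⟩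
    obtain ⟨b, -, hb⟩ := Option.mem_bind_iff.1 hu
    exact ⟨b, (eval_dom _).2 ⟨_, u, hb⟩⟩
  · rintro ⟨b, hb⟩
    obtain ⟨k, u, hu⟩ := (eval_dom _).1 hb
    exact ⟨Nat.pair (Encodable.encode b) k, u, by simpa [search] using hu⟩

end RecursivelyEnumerable

theorem primrec_nat_pow : Primrec₂ ((· ^ ·) : ℕ → ℕ → ℕ) :=
  Primrec₂.unpaired'.1 Nat.Primrec.pow

theorem primrec_natAbs : Primrec Int.natAbs := by
  refine (Primrec.nat_div2.comp (Primrec.succ.comp Primrec.encode) :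
    Primrec fun z : ℤ => (Encodable.encode z).succ.div2).of_eq fun z => ?_
  rcases z with x | x
  · change (2 * x + 1).div2 = x
    simp [Nat.div2_val]
  · change (2 * x + 1 + 1).div2 = x + 1
    simp [Nat.div2_val]

theorem primrec_toNat : Primrec Int.toNat := by
  refine (Primrec.cond (Primrec.nat_bodd.comp Primrec.encode) (Primrec.const 0)
    (Primrec.nat_div2.comp Primrec.encode) :
    Primrec fun z : ℤ => bif (Encodable.encode z).bodd then 0 else
      (Encodable.encode z).div2).of_eq fun z => ?_
  rcases z with x | x
  · change (bif (2 * x).bodd then 0 else (2 * x).div2) = x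
    simp [Nat.div2_val]
  · change (bif (2 * x + 1).bodd then 0 else (2 * x + 1).div2) = 0
    simp

theorem primrec_natAbs_sub : Primrec₂ fun x y : ℤ => (x - y).natAbs := by
  -- `x - y` is the difference of these two natural numbers.
  have hleft : Primrec fun z : ℤ × ℤ => z.1.toNat + (z.2.natAbs - z.2.toNat) :=
    Primrec.nat_add.comp (primrec_toNat.comp Primrec.fst) (Primrec.nat_sub.comp
      (primrec_natAbs.comp Primrec.snd) (primrec_toNat.comp Primrec.snd))
  have hright : Primrec fun z : ℤ × ℤ => z.2.toNat + (z.1.natAbs - z.1.toNat) :=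
    hleft.comp (Primrec.snd.pair Primrec.fst)
  refine (Primrec.nat_add.comp (Primrec.nat_sub.comp hleft hright)
    (Primrec.nat_sub.comp hright hleft)).of_eq fun z => ?_
  dsimp only
  omega

/-! ### Effectively open families and an effective Borel–Cantelli lemma -/

section EffectivelyOpen

variable {I : Set ℝ≥0} {α β : Type*} [Primcodable α] [Primcodable β]

/-- Families of sets of paths that are effectively open uniformly in an index from an arbitrary
coded type; for `α = ℕ` this is `UniformlyEffectivelyOpen`. -/
def EffectivelyOpenFamily (A : α → Set C(I, ℝ)) : Prop :=
  ∃ W : α × BallCode → Prop, REPred W ∧ ∀ a, A a = {f | ∃ c, W (a, c) ∧ f ∈ basicOpen I c}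

theorem EffectivelyOpenFamily.comp {A : β → Set C(I, ℝ)} (hA : EffectivelyOpenFamily A)
    {g : α → β} (hg : Computable g) : EffectivelyOpenFamily fun a => A (g a) := by
  obtain ⟨W, hW, hWA⟩ := hA
  exact ⟨fun x => W (g x.1, x.2),
    rePred_comp hW ((hg.comp Computable.fst).pair Computable.snd), fun a => hWA (g a)⟩

theorem EffectivelyOpenFamily.biUnion {A : α × β → Set C(I, ℝ)} (hA : EffectivelyOpenFamily A)
    {p : α × β → Prop} (hp : REPred p) :
    EffectivelyOpenFamily fun a => {f | ∃ b, p (a, b) ∧ f ∈ A (a, b)} := by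
  obtain ⟨W, hW, hWA⟩ := hA
  refine ⟨fun x => ∃ b, p (x.1, b) ∧ W ((x.1, b), x.2), ?_, fun a => ?_⟩
  · have hab : Computable fun y : (α × BallCode) × β => (y.1.1, y.2) :=
      ((Primrec.fst.comp Primrec.fst).pair Primrec.snd).to_comp
    exact rePred_exists
      (p := fun y : (α × BallCode) × β => p (y.1.1, y.2) ∧ W ((y.1.1, y.2), y.1.2))
      (rePred_and (rePred_comp hp hab)
        (rePred_comp hW (hab.pair (Computable.snd.comp Computable.fst))))
  · ext f
    simp only [hWA, Set.mem_ofPred_eq]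
    constructor
    · rintro ⟨b, hb, c, hc, hf⟩
      exact ⟨c, ⟨b, hb, hc⟩, hf⟩
    · rintro ⟨c, ⟨b, hb, hc⟩, hf⟩
      exact ⟨b, hb, c, hc, hf⟩

end EffectivelyOpen

theorem exists_measure_tail_le {X : Type*} [MeasurableSpace X] (μ : Measure X) {A : ℕ → Set X}
    {C ρ : ℝ≥0∞} (hC : C ≠ ⊤) (hρ : ρ < 1) (hA : ∀ n, μ (A n) ≤ C * ρ ^ n) :
    ∃ b e : ℕ, ∀ m, μ {f | ∃ n, b * m + e ≤ n ∧ f ∈ A n} ≤ 2⁻¹ ^ m := by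
  have hpow := ENNReal.tendsto_pow_atTop_nhds_zero_of_lt_one hρ
  obtain ⟨b, hb⟩ := (hpow.eventually_le_const (u := 2⁻¹) (by simp)).exists
  have hC' : C * (1 - ρ)⁻¹ ≠ ⊤ :=
    ENNReal.mul_ne_top hC (ENNReal.inv_ne_top.2 (tsub_pos_of_lt hρ).ne')
  have hpow' := ENNReal.Tendsto.const_mul hpow (Or.inr hC')
  rw [mul_zero] at hpow'
  obtain ⟨e, he⟩ := (hpow'.eventually_le_const (u := 1) one_pos).exists
  refine ⟨b, e, fun m => ?_⟩
  have hsub : {f | ∃ n, b * m + e ≤ n ∧ f ∈ A n} ⊆ ⋃ n, A (b * m + e + n) := by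
    rintro f ⟨n, hn, hf⟩
    exact Set.mem_iUnion.2 ⟨n - (b * m + e), by rwa [Nat.add_sub_cancel' hn]⟩
  calc μ {f | ∃ n, b * m + e ≤ n ∧ f ∈ A n}
      ≤ ∑' n, μ (A (b * m + e + n)) := (measure_mono hsub).trans (measure_iUnion_le _)
    _ ≤ ∑' n, C * ρ ^ (b * m + e) * ρ ^ n :=
        ENNReal.tsum_le_tsum fun n => by rw [mul_assoc, ← pow_add]; exact hA _
    _ = C * (1 - ρ)⁻¹ * ρ ^ e * (ρ ^ b) ^ m := by
        rw [ENNReal.tsum_mul_left, ENNReal.tsum_geometric, pow_add, pow_mul]; ring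
    _ ≤ 1 * 2⁻¹ ^ m := by gcongr
    _ = 2⁻¹ ^ m := one_mul _

theorem IsMLRandom.eventually_notMem {I : Set ℝ≥0} {μ : Measure C(I, ℝ)} {B : C(I, ℝ)}
    (hB : IsMLRandom μ B) {A : ℕ → Set C(I, ℝ)} (hA : EffectivelyOpenFamily A)
    {C ρ : ℝ≥0∞} (hC : C ≠ ⊤) (hρ : ρ < 1) (hμA : ∀ n, μ (A n) ≤ C * ρ ^ n) :
    ∀ᶠ n in atTop, B ∉ A n := by
  obtain ⟨b, e, htail⟩ := exists_measure_tail_le μ hC hρ hμA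
  have hpre : PrimrecPred fun x : ℕ × ℕ => b * x.1 + e ≤ x.2 :=
    Primrec.nat_le.comp (Primrec.nat_add.comp (Primrec.nat_mul.comp (Primrec.const b) Primrec.fst)
      (Primrec.const e)) Primrec.snd
  have htest : IsMLTest μ fun m => {f | ∃ n, b * m + e ≤ n ∧ f ∈ A n} :=
    ⟨(hA.comp Computable.snd).biUnion (rePred_of_primrecPred hpre), htail⟩
  obtain ⟨m, hm⟩ : ∃ m, ∀ n ≥ b * m + e, B ∉ A n := by
    simpa only [Set.mem_iInter, Set.mem_ofPred_eq, not_forall, not_exists, not_and] using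
      hB _ htest
  exact eventually_atTop.2 ⟨_, hm⟩

/-! ### Rational piecewise linear approximation -/

theorem sum_hat (n : ℕ) {s : ℝ} (hs : 0 ≤ s) :
    ∑ k : Fin n, max 0 (1 - |s - (k : ℕ)|) = max 0 (min 1 (n - s)) := by
  rw [Fin.sum_univ_eq_sum_range fun k => max 0 (1 - |s - (k : ℝ)|)]
  induction n with
  | zero =>
    rw [Finset.sum_range_zero, max_eq_left]
    exact (min_le_right _ _).trans (by simpa using hs)
  | succ n ih =>
    rw [Finset.sum_range_succ, ih]
    push_cast
    grind [abs_of_nonneg, abs_of_nonpos]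

theorem interpolant_grid (m d : ℕ) (v : List ℤ) (k : ℕ) :
    interpolant m d v (k / ((m : ℝ) + 1)) = (v.getD k 0 : ℝ) / ((d : ℝ) + 1) := by
  have hm : (m : ℝ) + 1 ≠ 0 := by positivity
  have hat_eq_zero : ∀ i : ℕ, i ≠ k → max 0 (1 - |(k : ℝ) - i|) = 0 := by
    intro i hi
    have : (1 : ℤ) ≤ |(k : ℤ) - i| := Int.one_le_abs (by lia)
    have : (1 : ℝ) ≤ |(k : ℝ) - i| := by exact_mod_cast this
    exact max_eq_left (by linarith)
  unfold interpolant
  rw [mul_div_cancel₀ _ hm]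
  by_cases hk : k < v.length
  · rw [Finset.sum_eq_single ⟨k, hk⟩]
    · simp [hk]
    · intro i _ hi
      rw [hat_eq_zero i (fun h => hi (Fin.ext h)), mul_zero]
    · simp
  · rw [List.getD_eq_default _ _ (not_lt.1 hk), Int.cast_zero, zero_div]
    refine Finset.sum_eq_zero fun i _ => ?_
    rw [hat_eq_zero i (by lia), mul_zero]

theorem abs_interpolant_sub_le {m d : ℕ} {v : List ℤ} {t y η : ℝ} (ht : 0 ≤ t)
    (hlen : ((m : ℝ) + 1) * t + 1 ≤ v.length)
    (h : ∀ k : Fin v.length, |t - k / ((m : ℝ) + 1)| < 1 / ((m : ℝ) + 1) →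
      |(v.get k : ℝ) / ((d : ℝ) + 1) - y| ≤ η) :
    |interpolant m d v t - y| ≤ η := by
  have hm : (0 : ℝ) < (m : ℝ) + 1 := by positivity
  let hat (k : Fin v.length) : ℝ := max 0 (1 - |((m : ℝ) + 1) * t - (k : ℕ)|)
  have hat_nonneg (k : Fin v.length) : 0 ≤ hat k := le_max_left _ _
  have sum_hat_eq_one : ∑ k, hat k = 1 := by
    rw [sum_hat _ (by positivity), min_eq_left (by linarith), max_eq_right zero_le_one]
  have near_of_hat_pos (k : Fin v.length) (hk : 0 < hat k) :
      |t - k / ((m : ℝ) + 1)| < 1 / ((m : ℝ) + 1) := by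
    have hk : |((m : ℝ) + 1) * t - (k : ℕ)| < 1 := by
      simpa only [hat, lt_max_iff, lt_irrefl, false_or, sub_pos] using hk
    rwa [← mul_lt_mul_iff_right₀ hm, ← abs_of_pos hm, ← abs_mul, abs_of_pos hm, mul_sub,
      mul_div_cancel₀ _ hm.ne', mul_div_cancel₀ _ hm.ne']
  calc |interpolant m d v t - y|
      = |∑ k, ((v.get k : ℝ) / ((d : ℝ) + 1) - y) * hat k| := by
        simp only [sub_mul, Finset.sum_sub_distrib, ← Finset.mul_sum, sum_hat_eq_one, mul_one]
        rfl
    _ ≤ ∑ k, |((v.get k : ℝ) / ((d : ℝ) + 1) - y) * hat k| := Finset.abs_sum_le_sum_abs _ _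
    _ ≤ ∑ k, η * hat k := by
        refine Finset.sum_le_sum fun k _ => ?_
        rw [abs_mul, abs_of_nonneg (hat_nonneg k)]
        rcases (hat_nonneg k).eq_or_lt with h0 | hpos
        · rw [← h0, mul_zero, mul_zero]
        · exact mul_le_mul_of_nonneg_right (h k (near_of_hat_pos k hpos)) hpos.le
    _ = η := by rw [← Finset.mul_sum, sum_hat_eq_one, mul_one]

theorem abs_floor_div_sub_le (y : ℝ) (d : ℕ) :
    |(⌊y * ((d : ℝ) + 1)⌋ : ℝ) / ((d : ℝ) + 1) - y| ≤ 1 / ((d : ℝ) + 1) := by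
  have hd : (0 : ℝ) < (d : ℝ) + 1 := by positivity
  have hle := Int.floor_le (y * ((d : ℝ) + 1))
  have hlt := Int.lt_floor_add_one (y * ((d : ℝ) + 1))
  rw [div_sub' hd.ne', abs_div, abs_of_pos hd]
  gcongr
  rw [abs_le]
  constructor <;> linarith

/-- Numerators of the values of `F` at the points `k / (m + 1)` of `[0, N + 1]`, rounded down to
multiples of `1 / (d + 1)`: the data of a rational interpolant of `F`. -/
def gridSamples (F : ℝ≥0 → ℝ) (N m d : ℕ) : List ℤ :=
  (List.range ((N + 1) * (m + 1) + 1)).map fun k : ℕ =>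
    ⌊F (k / ((m : ℝ≥0) + 1)) * ((d : ℝ) + 1)⌋

theorem abs_interpolant_gridSamples_sub_le {F : ℝ≥0 → ℝ} {N m d : ℕ} {η : ℝ}
    (hosc : ∀ s ≤ (N : ℝ≥0) + 1, ∀ t ≤ (N : ℝ≥0) + 1, |(s : ℝ) - t| < 1 / ((m : ℝ) + 1) →
      |F s - F t| ≤ η) {t : ℝ≥0} (ht : t ≤ (N : ℝ≥0) + 1) :
    |interpolant m d (gridSamples F N m d) t - F t| ≤ 1 / ((d : ℝ) + 1) + η := by
  have htN : (t : ℝ) ≤ N + 1 := by exact_mod_cast ht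
  refine abs_interpolant_sub_le t.2 ?_ fun k hk => ?_
  · simp only [gridSamples, List.length_map, List.length_range]
    push_cast
    nlinarith [htN]
  · have hkN : (k : ℕ) ≤ (N + 1) * (m + 1) := by
      simpa [gridSamples, Nat.lt_succ_iff] using k.2
    set s : ℝ≥0 := (k : ℕ) / ((m : ℝ≥0) + 1) with hs
    have hsN : s ≤ (N : ℝ≥0) + 1 := by
      rw [hs, div_le_iff₀ (by positivity)]
      exact_mod_cast hkN
    have hst : |F s - F t| ≤ η := by
      refine hosc s hsN t ht ?_
      rw [abs_sub_comm, hs]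
      exact_mod_cast hk
    have hround := abs_floor_div_sub_le (F s) d
    have hget : (gridSamples F N m d).get k = ⌊F s * ((d : ℝ) + 1)⌋ := by
      rw [List.get_eq_getElem]
      simp [gridSamples, hs]
    rw [hget]
    exact (abs_sub_le _ (F s) _).trans (add_le_add hround hst)

section PathVal

variable {I : Set ℝ≥0}

/-- The path `f` as a function on all of `ℝ≥0`, with value `0` outside of its domain `I`. -/
def pathVal (f : C(I, ℝ)) : ℝ≥0 → ℝ :=
  Function.extend Subtype.val f 0

theorem pathVal_coe (f : C(I, ℝ)) (t : I) : pathVal f t = f t :=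
  Subtype.val_injective.extend_apply _ _ _

theorem pathVal_of_mem (f : C(I, ℝ)) {t : ℝ≥0} (ht : t ∈ I) : pathVal f t = f ⟨t, ht⟩ :=
  pathVal_coe f ⟨t, ht⟩

theorem continuousOn_pathVal (f : C(I, ℝ)) : ContinuousOn (pathVal f) I := by
  rw [continuousOn_iff_continuous_domRestrict]
  exact f.continuous.congr fun t => (pathVal_coe f t).symm

theorem exists_pos_forall_abs_pathVal_sub_lt (f : C(I, ℝ)) {T : ℝ≥0} (hT : Set.Iic T ⊆ I) {η : ℝ}
    (hη : 0 < η) :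
    ∃ δ > 0, ∀ s ≤ T, ∀ t ≤ T, |(s : ℝ) - t| < δ → |pathVal f s - pathVal f t| < η := by
  have hcompact : IsCompact (Set.Iic T) := by
    rw [← Set.Icc_bot]
    exact isCompact_Icc
  have huc := hcompact.uniformContinuousOn_of_continuous ((continuousOn_pathVal f).mono hT)
  obtain ⟨δ, hδ, h⟩ := Metric.uniformContinuousOn_iff.1 huc η hη
  exact ⟨δ, hδ, fun s hs t ht => h s hs t ht⟩

theorem exists_mem_basicOpen (f : C(I, ℝ)) {N : ℕ} (hNI : Set.Iic ((N : ℝ≥0) + 1) ⊆ I) {G : ℕ}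
    (hG : 0 < G) {η : ℝ} (hη : 0 < η) :
    ∃ (M m d r : ℕ) (v : List ℤ), m + 1 = M * G ∧ ((r : ℝ) + 1) / ((d : ℝ) + 1) < η ∧
      f ∈ basicOpen I (N, m, d, r, v) := by
  obtain ⟨d, hd⟩ := exists_nat_one_div_lt (show 0 < η / 3 by positivity)
  have hd₀ : (0 : ℝ) < 1 / ((d : ℝ) + 1) := Nat.one_div_pos_of_nat
  obtain ⟨δ, hδ, hosc⟩ := exists_pos_forall_abs_pathVal_sub_lt f hNI hd₀
  obtain ⟨M, hM⟩ := exists_nat_one_div_lt hδ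
  obtain ⟨m, hm⟩ : ∃ m, m + 1 = (M + 1) * G := ⟨(M + 1) * G - 1, by
    have := Nat.mul_pos M.succ_pos hG
    lia⟩
  have hmesh : 1 / ((m : ℝ) + 1) < δ := by
    have : (M : ℝ) + 1 ≤ m + 1 := by exact_mod_cast hm ▸ Nat.le_mul_of_pos_right _ hG
    exact (one_div_le_one_div_of_le (by positivity) this).trans_lt hM
  refine ⟨M + 1, m, d, 2, gridSamples (pathVal f) N m d, hm, ?_, fun t ht => ?_⟩
  · push_cast
    linarith [mul_one_div ((2 : ℝ) + 1) ((d : ℝ) + 1)]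
  · have happrox := abs_interpolant_gridSamples_sub_le (d := d)
      (fun s hs t ht hst => (hosc s hs t ht (hst.trans hmesh)).le) ht
    rw [← pathVal_coe f t, abs_sub_comm]
    push_cast
    linarith [mul_one_div ((2 : ℝ) + 1) ((d : ℝ) + 1)]

theorem div_le_of_le_mul {N G j : ℕ} (hG : 0 < G) (hj : j ≤ (N + 1) * G) :
    (j : ℝ≥0) / G ≤ (N : ℝ≥0) + 1 := by
  rw [div_le_iff₀ (by exact_mod_cast hG)]
  exact_mod_cast hj

theorem abs_pathVal_sub_lt_of_mem_basicOpen {f : C(I, ℝ)} {N m d r M G j : ℕ} {v : List ℤ}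
    (hNI : Set.Iic ((N : ℝ≥0) + 1) ⊆ I) (hf : f ∈ basicOpen I (N, m, d, r, v))
    (hm : m + 1 = M * G) (hj : j ≤ (N + 1) * G) :
    |pathVal f (j / G) - (v.getD (j * M) 0 : ℝ) / ((d : ℝ) + 1)| <
      ((r : ℝ) + 1) / ((d : ℝ) + 1) := by
  obtain ⟨hM, hG⟩ : 0 < M ∧ 0 < G := by
    rw [← CanonicallyOrderedAdd.mul_pos, ← hm]
    exact m.succ_pos
  have hx := div_le_of_le_mul hG hj
  have hgrid : ((j / G : ℝ≥0) : ℝ) = ((j * M : ℕ) : ℝ) / ((m : ℝ) + 1) := by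
    have : (m : ℝ) + 1 = M * G := by exact_mod_cast hm
    rw [this]
    push_cast
    field_simp
  have := hf ⟨_, hNI hx⟩ hx
  rw [pathVal_of_mem f (hNI hx), ← interpolant_grid, ← hgrid]
  exact this

end PathVal

/-! ### Effectively open events determined by two values of the path -/

section Plane

variable {I : Set ℝ≥0} {α : Type*} [Primcodable α]

/-- The open rational square with code `(x, y, r, d)`. -/
def rationalSquare : ℤ × ℤ × ℕ × ℕ → Set (ℝ × ℝ)
  | (x, y, r, d) =>
    Metric.ball ((x : ℝ) / ((d : ℝ) + 1), (y : ℝ) / ((d : ℝ) + 1)) (((r : ℝ) + 1) / ((d : ℝ) + 1))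

theorem mem_rationalSquare {z : ℝ × ℝ} {x y : ℤ} {r d : ℕ} :
    z ∈ rationalSquare (x, y, r, d) ↔
      |z.1 - x / ((d : ℝ) + 1)| < ((r : ℝ) + 1) / ((d : ℝ) + 1) ∧
        |z.2 - y / ((d : ℝ) + 1)| < ((r : ℝ) + 1) / ((d : ℝ) + 1) := by
  simp only [rationalSquare, Metric.mem_ball, Prod.dist_eq, max_lt_iff, Real.dist_eq]

/-- Families of open subsets of the plane that are effectively open uniformly in the index, in the
following form: `Q` enumerates rational squares contained in the set, and among them are all
sufficiently small squares around each of its points. The latter makes it possible to read off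
membership from an approximation of the point that is not of one's choosing. -/
def EffectivelyOpenInPlane (O : α → Set (ℝ × ℝ)) : Prop :=
  ∃ Q : α × ℤ × ℤ × ℕ × ℕ → Prop, REPred Q ∧
    (∀ a c, Q (a, c) → rationalSquare c ⊆ O a) ∧
    ∀ a, ∀ z ∈ O a, ∃ η > 0, ∀ (x y : ℤ) (r d : ℕ), ((r : ℝ) + 1) / ((d : ℝ) + 1) < η →
      z ∈ rationalSquare (x, y, r, d) → Q (a, x, y, r, d)

theorem effectivelyOpenInPlane_lt_abs_sub {p q : α → ℕ} (hp : Primrec p) (hq : Primrec q)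
    (hq₀ : ∀ a, 0 < q a) :
    EffectivelyOpenInPlane fun a => {z : ℝ × ℝ | (p a : ℝ) / q a < |z.1 - z.2|} := by
  let Q : α × ℤ × ℤ × ℕ × ℕ → Prop := fun ⟨a, x, y, r, d⟩ =>
    p a * (d + 1) + 2 * (r + 1) * q a ≤ (x - y).natAbs * q a
  have hQ (a x y r d) : Q (a, x, y, r, d) ↔ (p a : ℝ) / q a + 2 * (((r : ℝ) + 1) / ((d : ℝ) + 1)) ≤
      |(x : ℝ) / ((d : ℝ) + 1) - y / ((d : ℝ) + 1)| := by
    have hd : (0 : ℝ) < (d : ℝ) + 1 := by positivity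
    have hqa : (0 : ℝ) < q a := by exact_mod_cast hq₀ a
    rw [← sub_div, abs_div, abs_of_pos hd, le_div_iff₀ hd, ← mul_le_mul_iff_left₀ hqa,
      show (((p a : ℝ) / q a + 2 * (((r : ℝ) + 1) / ((d : ℝ) + 1))) * (d + 1)) * q a =
        p a * (d + 1) + 2 * (r + 1) * q a by field_simp]
    simp only [Q]
    rw [← @Nat.cast_le ℝ]
    push_cast [Nat.cast_natAbs]
    rfl
  have hQ_primrec : PrimrecPred Q := by
    have hx : Primrec fun c : α × ℤ × ℤ × ℕ × ℕ => c.2.1 := Primrec.fst.comp Primrec.snd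
    have hyrd : Primrec fun c : α × ℤ × ℤ × ℕ × ℕ => c.2.2 := Primrec.snd.comp Primrec.snd
    have hr := Primrec.fst.comp (Primrec.snd.comp hyrd)
    have hd := Primrec.snd.comp (Primrec.snd.comp hyrd)
    have hpa : Primrec fun c : α × ℤ × ℤ × ℕ × ℕ => p c.1 := hp.comp Primrec.fst
    have hqa : Primrec fun c : α × ℤ × ℤ × ℕ × ℕ => q c.1 := hq.comp Primrec.fst
    exact Primrec.nat_le.comp
      (Primrec.nat_add.comp (Primrec.nat_mul.comp hpa (Primrec.succ.comp hd))
        (Primrec.nat_mul.comp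
          (Primrec.nat_mul.comp (Primrec.const 2) (Primrec.succ.comp hr)) hqa))
      (Primrec.nat_mul.comp (primrec_natAbs_sub.comp hx (Primrec.fst.comp hyrd)) hqa)
  have habs (z₁ z₂ x y : ℝ) : |(|z₁ - z₂| - |x - y|)| ≤ |z₁ - x| + |z₂ - y| := by
    refine (abs_abs_sub_abs_le _ _).trans ?_
    rw [sub_sub_sub_comm]
    exact abs_sub _ _
  refine ⟨Q, rePred_of_primrecPred hQ_primrec, fun a c hc z hz => ?_, fun a z hz => ?_⟩
  · obtain ⟨x, y, r, d⟩ := c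
    rw [mem_rationalSquare] at hz
    have := (hQ a x y r d).1 hc
    have := abs_le.1 (habs z.1 z.2 (x / ((d : ℝ) + 1)) (y / ((d : ℝ) + 1)))
    rw [Set.mem_ofPred_eq]
    linarith
  · refine ⟨(|z.1 - z.2| - p a / q a) / 4, by linarith [Set.mem_ofPred_eq ▸ hz], ?_⟩
    intro x y r d hr hz'
    rw [mem_rationalSquare] at hz'
    have := abs_le.1 (habs z.1 z.2 (x / ((d : ℝ) + 1)) (y / ((d : ℝ) + 1)))
    exact (hQ a x y r d).2 (by linarith)

theorem effectivelyOpenInPlane_abs_fst_lt {p q : α → ℕ} (hp : Primrec p) (hq : Primrec q)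
    (hq₀ : ∀ a, 0 < q a) :
    EffectivelyOpenInPlane fun a => {z : ℝ × ℝ | |z.1| < (p a : ℝ) / q a} := by
  let Q : α × ℤ × ℤ × ℕ × ℕ → Prop := fun ⟨a, x, _, r, d⟩ =>
    (x.natAbs + (r + 1)) * q a ≤ p a * (d + 1)
  have hQ (a x y r d) : Q (a, x, y, r, d) ↔
      |(x : ℝ) / ((d : ℝ) + 1)| + ((r : ℝ) + 1) / ((d : ℝ) + 1) ≤ (p a : ℝ) / q a := by
    have hd : (0 : ℝ) < (d : ℝ) + 1 := by positivity
    have hqa : (0 : ℝ) < q a := by exact_mod_cast hq₀ a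
    rw [abs_div, abs_of_pos hd, ← add_div, div_le_div_iff₀ hd hqa]
    simp only [Q]
    rw [← @Nat.cast_le ℝ]
    push_cast [Nat.cast_natAbs]
    rfl
  have hQ_primrec : PrimrecPred Q := by
    have hx : Primrec fun c : α × ℤ × ℤ × ℕ × ℕ => c.2.1 := Primrec.fst.comp Primrec.snd
    have hyrd : Primrec fun c : α × ℤ × ℤ × ℕ × ℕ => c.2.2 := Primrec.snd.comp Primrec.snd
    have hr := Primrec.fst.comp (Primrec.snd.comp hyrd)
    have hd := Primrec.snd.comp (Primrec.snd.comp hyrd)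
    have hpa : Primrec fun c : α × ℤ × ℤ × ℕ × ℕ => p c.1 := hp.comp Primrec.fst
    have hqa : Primrec fun c : α × ℤ × ℤ × ℕ × ℕ => q c.1 := hq.comp Primrec.fst
    exact Primrec.nat_le.comp
      (Primrec.nat_mul.comp
        (Primrec.nat_add.comp (primrec_natAbs.comp hx) (Primrec.succ.comp hr)) hqa)
      (Primrec.nat_mul.comp hpa (Primrec.succ.comp hd))
  refine ⟨Q, rePred_of_primrecPred hQ_primrec, fun a c hc z hz => ?_, fun a z hz => ?_⟩
  · obtain ⟨x, y, r, d⟩ := c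
    rw [mem_rationalSquare] at hz
    have := (hQ a x y r d).1 hc
    have := abs_sub_abs_le_abs_sub z.1 (x / ((d : ℝ) + 1))
    rw [Set.mem_ofPred_eq]
    linarith
  · refine ⟨(p a / q a - |z.1|) / 2, by linarith [Set.mem_ofPred_eq ▸ hz], ?_⟩
    intro x y r d hr hz'
    rw [mem_rationalSquare] at hz'
    have := abs_sub_abs_le_abs_sub (x / ((d : ℝ) + 1)) z.1
    rw [abs_sub_comm] at this
    exact (hQ a x y r d).2 (by linarith)

/-- The ball with the given code forces the point `(f (i a / G a), f (j a / G a))` into a square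
enumerated by `Q`. The witness `M` says that the grid of the centre of the ball refines the grid
`ℕ / G a`, so that the centre takes the two values `v.getD (i a * M) 0 / (d + 1)` and
`v.getD (j a * M) 0 / (d + 1)`. -/
def ForcesIntoSquare (Q : α × ℤ × ℤ × ℕ × ℕ → Prop) (N : ℕ) (i j G : α → ℕ) :
    α × BallCode → Prop
  | (a, N', m, d, r, v) =>
    ∃ M, (N' = N ∧ m + 1 = M * G a ∧ i a ≤ (N + 1) * G a ∧ j a ≤ (N + 1) * G a) ∧
      Q (a, v.getD (i a * M) 0, v.getD (j a * M) 0, r, d)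

theorem rePred_forcesIntoSquare {Q : α × ℤ × ℤ × ℕ × ℕ → Prop} (hQ : REPred Q) (N : ℕ)
    {i j G : α → ℕ} (hi : Primrec i) (hj : Primrec j) (hG : Primrec G) :
    REPred (ForcesIntoSquare Q N i j G) := by
  have ha : Primrec fun x : (α × BallCode) × ℕ => x.1.1 := Primrec.fst.comp Primrec.fst
  have hN : Primrec fun x : (α × BallCode) × ℕ => x.1.2.1 :=
    Primrec.fst.comp (Primrec.snd.comp Primrec.fst)
  have hmdrv : Primrec fun x : (α × BallCode) × ℕ => x.1.2.2 :=
    Primrec.snd.comp (Primrec.snd.comp Primrec.fst)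
  have hm := Primrec.fst.comp hmdrv
  have hd := Primrec.fst.comp (Primrec.snd.comp hmdrv)
  have hr := Primrec.fst.comp (Primrec.snd.comp (Primrec.snd.comp hmdrv))
  have hv := Primrec.snd.comp (Primrec.snd.comp (Primrec.snd.comp hmdrv))
  have hia := hi.comp ha
  have hja := hj.comp ha
  have hGa := hG.comp ha
  have hNG := Primrec.nat_mul.comp (Primrec.const (N + 1)) hGa
  have hgrid : PrimrecPred fun x : (α × BallCode) × ℕ => x.1.2.1 = N ∧
      x.1.2.2.1 + 1 = x.2 * G x.1.1 ∧ i x.1.1 ≤ (N + 1) * G x.1.1 ∧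
        j x.1.1 ≤ (N + 1) * G x.1.1 :=
    (Primrec.eq.comp hN (Primrec.const N)).and <|
      (Primrec.eq.comp (Primrec.succ.comp hm) (Primrec.nat_mul.comp Primrec.snd hGa)).and <|
        (Primrec.nat_le.comp hia hNG).and (Primrec.nat_le.comp hja hNG)
  have hx := (Primrec.list_getD 0).comp hv (Primrec.nat_mul.comp hia Primrec.snd)
  have hy := (Primrec.list_getD 0).comp hv (Primrec.nat_mul.comp hja Primrec.snd)
  exact rePred_exists <| rePred_and (rePred_of_primrecPred hgrid)
    (rePred_comp hQ (ha.pair (hx.pair (hy.pair (hr.pair hd)))).to_comp)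

theorem EffectivelyOpenInPlane.effectivelyOpenFamily_pathVal {O : α → Set (ℝ × ℝ)}
    (hO : EffectivelyOpenInPlane O) {N : ℕ} (hNI : Set.Iic ((N : ℝ≥0) + 1) ⊆ I) {i j G : α → ℕ}
    (hi : Primrec i) (hj : Primrec j) (hG : Primrec G) (hG₀ : ∀ a, 0 < G a) :
    EffectivelyOpenFamily fun a => {f : C(I, ℝ) | i a ≤ (N + 1) * G a ∧ j a ≤ (N + 1) * G a ∧
      (pathVal f (i a / G a), pathVal f (j a / G a)) ∈ O a} := by
  obtain ⟨Q, hQ, hQO, hOQ⟩ := hO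
  refine ⟨ForcesIntoSquare Q N i j G, rePred_forcesIntoSquare hQ N hi hj hG, fun a => ?_⟩
  ext f
  constructor
  · rintro ⟨hia, hja, hz⟩
    obtain ⟨η, hη, hsmall⟩ := hOQ a _ hz
    obtain ⟨M, m, d, r, v, hm, hr, hf⟩ := exists_mem_basicOpen f hNI (hG₀ a) hη
    refine ⟨(N, m, d, r, v), ⟨M, ⟨rfl, hm, hia, hja⟩, hsmall _ _ r d hr ?_⟩, hf⟩
    exact mem_rationalSquare.2 ⟨abs_pathVal_sub_lt_of_mem_basicOpen hNI hf hm hia,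
      abs_pathVal_sub_lt_of_mem_basicOpen hNI hf hm hja⟩
  · rintro ⟨⟨N', m, d, r, v⟩, ⟨M, ⟨rfl, hm, hia, hja⟩, hQa⟩, hf⟩
    refine ⟨hia, hja, hQO _ _ hQa ?_⟩
    exact mem_rationalSquare.2 ⟨abs_pathVal_sub_lt_of_mem_basicOpen hNI hf hm hia,
      abs_pathVal_sub_lt_of_mem_basicOpen hNI hf hm hja⟩

end Plane

/-! ### Gaussian estimates -/

theorem gaussianReal_setOf_lt_abs_le {v c : ℝ≥0} (hvc : v ≤ c) {ε : ℝ} (hε : 0 ≤ ε) :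
    gaussianReal 0 v {x | ε < |x|} ≤ ENNReal.ofReal (2 * Real.exp (-ε ^ 2 / (2 * c))) := by
  have hsub : HasSubgaussianMGF id c (gaussianReal 0 v) := by
    refine ⟨fun t => integrable_exp_mul_gaussianReal t, fun t => ?_⟩
    rw [mgf_id_gaussianReal]
    simp only [zero_mul, zero_add]
    gcongr
  have hright := hsub.measure_ge_le hε
  have hleft := hsub.neg.measure_ge_le hε
  have hsplit : {x : ℝ | ε < |x|} ⊆ {x | ε ≤ id x} ∪ {x | ε ≤ (-id) x} := fun x hx =>
    (lt_abs.1 hx).imp (fun h => h.le) (fun h => show ε ≤ -x from h.le)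
  rw [← ofReal_measureReal]
  refine ENNReal.ofReal_le_ofReal ?_
  calc (gaussianReal 0 v).real {x | ε < |x|}
      ≤ (gaussianReal 0 v).real ({x | ε ≤ id x} ∪ {x | ε ≤ (-id) x}) := measureReal_mono hsplit
    _ ≤ _ := measureReal_union_le _ _
    _ ≤ 2 * Real.exp (-ε ^ 2 / (2 * c)) := by rw [two_mul]; exact add_le_add hright hleft

theorem gaussianPDF_le_of_le {r v : ℝ≥0} (hr : 0 < r) (hrv : r ≤ v) (m x : ℝ) :
    gaussianPDF m v x ≤ ENNReal.ofReal (√(2 * Real.pi * r))⁻¹ := by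
  rw [gaussianPDF_def]
  refine ENNReal.ofReal_le_ofReal ?_
  have hexp : Real.exp (-(x - m) ^ 2 / (2 * v)) ≤ 1 :=
    Real.exp_le_one_iff.2 (div_nonpos_of_nonpos_of_nonneg (by nlinarith) (by positivity))
  calc (√(2 * Real.pi * v))⁻¹ * Real.exp (-(x - m) ^ 2 / (2 * v))
      ≤ (√(2 * Real.pi * v))⁻¹ := mul_le_of_le_one_right (by positivity) hexp
    _ ≤ (√(2 * Real.pi * r))⁻¹ := by gcongr

theorem gaussianReal_setOf_abs_lt_le {r v : ℝ≥0} (hr : 0 < r) (hrv : r ≤ v) (ε : ℝ) :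
    gaussianReal 0 v {x | |x| < ε} ≤
      ENNReal.ofReal (√(2 * Real.pi * r))⁻¹ * ENNReal.ofReal (2 * ε) := by
  have hball : {x : ℝ | |x| < ε} = Metric.ball 0 ε := by
    ext x
    simp
  rw [gaussianReal_apply _ (hr.trans_le hrv).ne', hball]
  calc ∫⁻ x in Metric.ball 0 ε, gaussianPDF 0 v x
      ≤ ∫⁻ _ in Metric.ball 0 ε, ENNReal.ofReal (√(2 * Real.pi * r))⁻¹ :=
        lintegral_mono (gaussianPDF_le_of_le hr hrv 0)
    _ = _ := by rw [setLIntegral_const, Real.volume_ball]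

theorem exists_forall_pow_mul_exp_neg_pow_le {a σ : ℝ} (ha : 0 ≤ a) (hσ : 1 < σ) :
    ∃ C : ℝ, ∀ n : ℕ, a ^ n * Real.exp (-σ ^ n) ≤ C := by
  obtain ⟨k, hk⟩ := pow_unbounded_of_one_lt a hσ
  refine ⟨k.factorial, fun n => ?_⟩
  have hexp : (σ ^ n) ^ k / k.factorial ≤ Real.exp (σ ^ n) :=
    Real.pow_div_factorial_le_exp _ (by positivity) k
  rw [Real.exp_neg, ← div_eq_mul_inv, div_le_iff₀ (Real.exp_pos _)]
  rw [div_le_iff₀' (by positivity)] at hexp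
  calc a ^ n ≤ (σ ^ k) ^ n := by gcongr
    _ = (σ ^ n) ^ k := by rw [← pow_mul, ← pow_mul, mul_comm]
    _ ≤ k.factorial * Real.exp (σ ^ n) := hexp

theorem exists_forall_card_mul_exp_neg_pow_le (N : ℕ) {σ : ℝ} (hσ : 1 < σ) :
    ∃ C : ℝ, ∀ n : ℕ, ((N + 1) * 2 ^ (n + 1) + 1) * (2 * Real.exp (-σ ^ n)) ≤ C * 2⁻¹ ^ n := by
  obtain ⟨C, hC⟩ := exists_forall_pow_mul_exp_neg_pow_le (a := 4) (by norm_num) hσ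
  refine ⟨4 * (N + 2) * C, fun n => ?_⟩
  have hcard : (N + 1) * 2 ^ (n + 1) + 1 ≤ 2 * (N + 2) * (2 : ℝ) ^ n := by
    have : (1 : ℝ) ≤ 2 ^ n := one_le_pow₀ one_le_two
    rw [pow_succ]
    linarith
  calc ((N + 1) * 2 ^ (n + 1) + 1) * (2 * Real.exp (-σ ^ n))
      ≤ 2 * (N + 2) * (2 : ℝ) ^ n * (2 * Real.exp (-σ ^ n)) := by gcongr
    _ = 4 * (N + 2) * (4 ^ n * Real.exp (-σ ^ n)) * 2⁻¹ ^ n := by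
      rw [show (4 : ℝ) = 2 * 2 by norm_num, mul_pow, inv_pow]
      field_simp
    _ ≤ 4 * (N + 2) * C * 2⁻¹ ^ n := by
      gcongr
      exact hC n

section Increments

variable {I : Set ℝ≥0} {μ : Measure C(I, ℝ)}

/-- Under `μ` the coordinate process starts at `0` and has centred normal increments whose variance
is the elapsed time. In contrast to `IsWienerMeasure` this only concerns the laws of single
increments, not their independence. -/
structure HasBrownianIncrements (μ : Measure C(I, ℝ)) : Prop where
  eval_zero : ∀ t : I, (t : ℝ≥0) = 0 → ∀ᵐ f ∂μ, f t = 0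
  law_increment : ∀ s t : I, s ≤ t →
    HasLaw (fun f : C(I, ℝ) => f t - f s) (gaussianReal 0 ((t : ℝ≥0) - (s : ℝ≥0))) μ

theorem IsWienerMeasure.hasBrownianIncrements (hμ : IsWienerMeasure μ) : HasBrownianIncrements μ :=
  ⟨hμ.eval_zero, hμ.law_increment⟩

theorem HasBrownianIncrements.measure_lt_abs_sub_le (hμ : HasBrownianIncrements μ) {s t c : ℝ≥0}
    (hs : s ∈ I) (ht : t ∈ I) (hst : s ≤ t) (hc : t - s ≤ c) {ε : ℝ} (hε : 0 ≤ ε) :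
    μ {f | ε < |pathVal f t - pathVal f s|} ≤
      ENNReal.ofReal (2 * Real.exp (-ε ^ 2 / (2 * c))) := by
  have hlaw := (hμ.law_increment ⟨s, hs⟩ ⟨t, ht⟩ hst).measure_eq (p := fun x => ε < |x|)
    (measurableSet_lt measurable_const measurable_id.abs)
  simp only [pathVal_of_mem _ hs, pathVal_of_mem _ ht]
  exact hlaw.trans_le (gaussianReal_setOf_lt_abs_le hc hε)

theorem HasBrownianIncrements.measure_abs_lt_le (hμ : HasBrownianIncrements μ) (h0 : 0 ∈ I)
    {r t : ℝ≥0} (ht : t ∈ I) (hr : 0 < r) (hrt : r ≤ t) (ε : ℝ) :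
    μ {f | |pathVal f t| < ε} ≤
      ENNReal.ofReal (√(2 * Real.pi * r))⁻¹ * ENNReal.ofReal (2 * ε) := by
  have hlaw := (hμ.law_increment ⟨0, h0⟩ ⟨t, ht⟩ (zero_le (a := t))).measure_eq
    (p := fun x => |x| < ε) (measurableSet_lt measurable_id.abs measurable_const)
  rw [tsub_zero] at hlaw
  refine le_trans (measure_mono_ae ?_)
    (hlaw.trans_le (gaussianReal_setOf_abs_lt_le hr hrt ε))
  filter_upwards [hμ.eval_zero ⟨0, h0⟩ rfl] with f hf0 hf
  change |f ⟨t, ht⟩ - f ⟨0, h0⟩| < ε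
  rw [hf0, sub_zero, ← pathVal_of_mem f ht]
  exact hf

end Increments

/-! ### Large increments and small values on dyadic grids -/

theorem measure_setOf_exists_le {X : Type*} [MeasurableSpace X] (μ : Measure X) {p : ℕ → Prop}
    {A : ℕ → Set X} {b : ℝ≥0∞} (hA : ∀ j, p j → μ (A j) ≤ b) :
    μ {f | ∃ j, p j ∧ f ∈ A j} ≤ ({j | p j}.encard : ℝ≥0∞) * b := by
  have hunion : {f | ∃ j, p j ∧ f ∈ A j} = ⋃ j ∈ {j | p j}, A j := by
    ext f
    simp
  calc μ {f | ∃ j, p j ∧ f ∈ A j} ≤ ∑' j : {j | p j}, μ (A j) := by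
        rw [hunion]
        exact measure_biUnion_le μ (Set.to_countable _) A
    _ ≤ ∑' _ : {j | p j}, b := ENNReal.tsum_le_tsum fun j => hA j j.2
    _ = ({j | p j}.encard : ℝ≥0∞) * b := ENNReal.tsum_set_const _ b

section Events

variable {I : Set ℝ≥0}

/-- The paths that move by more than `ρ ^ n` from some point of the grid `2⁻ⁿ⁻¹ℕ ∩ [0, N + 1]`
back to the last point of the coarser grid `2⁻ⁿℕ`, which is the point itself or its predecessor. -/
def largeIncrementEvent (I : Set ℝ≥0) (N : ℕ) (ρ : ℝ) (n : ℕ) : Set C(I, ℝ) :=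
  {f | ∃ j ≤ (N + 1) * 2 ^ (n + 1),
    ρ ^ n < |pathVal f (j / 2 ^ (n + 1)) - pathVal f (↑(j / 2 * 2) / 2 ^ (n + 1))|}

/-- The paths that are less than `D * ρ ^ n` in absolute value at some point `j / 2 ^ n` of
`[1 / R, N + 1]` with numerator in the set `S n`, where `S` is given as a relation. -/
def smallValueEvent (I : Set ℝ≥0) (S : ℕ × ℕ → Prop) (N R D : ℕ) (ρ : ℝ) (n : ℕ) :
    Set C(I, ℝ) :=
  {f | ∃ j, (S (n, j) ∧ j ≤ (N + 1) * 2 ^ n ∧ 2 ^ n ≤ j * R) ∧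
    |pathVal f (j / 2 ^ n)| < D * ρ ^ n}

variable {N : ℕ} (hNI : Set.Iic ((N : ℝ≥0) + 1) ⊆ I)
include hNI

theorem effectivelyOpenFamily_largeIncrementEvent (ρ : ℚ≥0) :
    EffectivelyOpenFamily (largeIncrementEvent I N ρ) := by
  have hG : Primrec fun x : ℕ × ℕ => 2 ^ (x.1 + 1) :=
    primrec_nat_pow.comp (Primrec.const 2) (Primrec.succ.comp Primrec.fst)
  have hpred : Primrec fun x : ℕ × ℕ => x.2 / 2 * 2 :=
    Primrec.nat_mul.comp (Primrec.nat_div.comp Primrec.snd (Primrec.const 2)) (Primrec.const 2)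
  have hj : PrimrecPred fun x : ℕ × ℕ => x.2 ≤ (N + 1) * 2 ^ (x.1 + 1) :=
    Primrec.nat_le.comp Primrec.snd (Primrec.nat_mul.comp (Primrec.const (N + 1)) hG)
  have hplane := effectivelyOpenInPlane_lt_abs_sub
    (primrec_nat_pow.comp (Primrec.const ρ.num) (Primrec.fst (α := ℕ) (β := ℕ)))
    (primrec_nat_pow.comp (Primrec.const ρ.den) Primrec.fst) fun _ => by positivity
  have hA := (hplane.effectivelyOpenFamily_pathVal hNI Primrec.snd hpred hG
    fun _ => by positivity).biUnion (rePred_of_primrecPred hj)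
  convert hA using 1
  ext n f
  have hle (j : ℕ) : j / 2 * 2 ≤ j := Nat.div_mul_le_self j 2
  simp only [largeIncrementEvent, NNRat.cast_def, div_pow, Set.mem_ofPred_eq, Nat.cast_pow,
    Nat.cast_ofNat]
  exact exists_congr fun j => ⟨fun ⟨hj, h⟩ => ⟨hj, hj, (hle j).trans hj, h⟩,
    fun ⟨hj, _, _, h⟩ => ⟨hj, h⟩⟩

theorem effectivelyOpenFamily_smallValueEvent {S : ℕ × ℕ → Prop} (hS : REPred S) (R D : ℕ)
    (ρ : ℚ≥0) : EffectivelyOpenFamily (smallValueEvent I S N R D ρ) := by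
  have hG : Primrec fun x : ℕ × ℕ => 2 ^ x.1 := primrec_nat_pow.comp (Primrec.const 2) Primrec.fst
  have hplane := effectivelyOpenInPlane_abs_fst_lt
    (Primrec.nat_mul.comp (Primrec.const D)
      (primrec_nat_pow.comp (Primrec.const ρ.num) (Primrec.fst (α := ℕ) (β := ℕ))))
    (primrec_nat_pow.comp (Primrec.const ρ.den) Primrec.fst) fun _ => by positivity
  have hR : PrimrecPred fun x : ℕ × ℕ => 2 ^ x.1 ≤ x.2 * R :=
    Primrec.nat_le.comp hG (Primrec.nat_mul.comp Primrec.snd (Primrec.const R))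
  have hA := (hplane.effectivelyOpenFamily_pathVal hNI Primrec.snd Primrec.snd hG
    fun _ => by positivity).biUnion (rePred_and hS (rePred_of_primrecPred hR))
  convert hA using 1
  ext n f
  simp only [smallValueEvent, NNRat.cast_def, div_pow, mul_div_assoc', Set.mem_ofPred_eq,
    Nat.cast_mul, Nat.cast_pow, Nat.cast_ofNat]
  exact exists_congr fun j => ⟨fun ⟨⟨hS, hjN, hjR⟩, h⟩ => ⟨⟨hS, hjR⟩, hjN, hjN, h⟩,
    fun ⟨⟨hS, hjR⟩, hjN, _, h⟩ => ⟨⟨hS, hjN, hjR⟩, h⟩⟩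

variable {μ : Measure C(I, ℝ)} (hμ : HasBrownianIncrements μ)
include hμ

theorem measure_smallValueEvent_le {S : ℕ × ℕ → Prop} (R D : ℕ) {ρ : ℝ} (hρ : 0 ≤ ρ)
    {C κ : ℝ≥0∞} (n : ℕ) (hS : ({j | S (n, j)}.encard : ℝ≥0∞) ≤ C * κ ^ n) :
    μ (smallValueEvent I S N R D ρ n) ≤
      C * ENNReal.ofReal (√(2 * Real.pi * (R : ℝ≥0)⁻¹))⁻¹ * ENNReal.ofReal (2 * D) *
        (κ * ENNReal.ofReal ρ) ^ n := by
  have hterm (j : ℕ) (hj : S (n, j) ∧ j ≤ (N + 1) * 2 ^ n ∧ 2 ^ n ≤ j * R) :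
      μ {f | |pathVal f (j / 2 ^ n)| < D * ρ ^ n} ≤
        ENNReal.ofReal (√(2 * Real.pi * (R : ℝ≥0)⁻¹))⁻¹ *
          (ENNReal.ofReal (2 * D) * ENNReal.ofReal ρ ^ n) := by
    obtain ⟨-, hjN, hjR⟩ := hj
    have hjI : (j / 2 ^ n : ℝ≥0) ∈ I :=
      hNI (by simpa using div_le_of_le_mul (G := 2 ^ n) (by positivity) hjN)
    have hR : (0 : ℝ≥0) < R := by
      have : 0 < R := Nat.pos_of_ne_zero fun h => by simp [h] at hjR
      exact_mod_cast this
    have hRj : (R : ℝ≥0)⁻¹ ≤ j / 2 ^ n := by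
      rw [inv_le_iff_one_le_mul₀ hR, div_mul_eq_mul_div, le_div_iff₀ (by positivity), one_mul]
      exact_mod_cast hjR
    rw [← ENNReal.ofReal_pow hρ, ← ENNReal.ofReal_mul (by positivity), mul_assoc 2 (D : ℝ)]
    exact hμ.measure_abs_lt_le (hNI (by simp)) hjI (inv_pos.2 hR) hRj _
  calc μ (smallValueEvent I S N R D ρ n)
      ≤ _ := measure_setOf_exists_le μ hterm
    _ ≤ C * κ ^ n * (ENNReal.ofReal (√(2 * Real.pi * (R : ℝ≥0)⁻¹))⁻¹ *
          (ENNReal.ofReal (2 * D) * ENNReal.ofReal ρ ^ n)) := by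
        gcongr
        refine le_trans ?_ hS
        gcongr
        exact fun hj => hj.1
    _ = _ := by ring

theorem measure_pow_lt_abs_sub_pred_le {ρ : ℝ} (hρ : 0 ≤ ρ) {n j : ℕ}
    (hj : j ≤ (N + 1) * 2 ^ (n + 1)) :
    μ {f | ρ ^ n < |pathVal f (j / 2 ^ (n + 1)) - pathVal f (↑(j / 2 * 2) / 2 ^ (n + 1))|} ≤
      ENNReal.ofReal (2 * Real.exp (-(2 * ρ ^ 2) ^ n)) := by
  have hmem (i : ℕ) (hi : i ≤ j) : (i / 2 ^ (n + 1) : ℝ≥0) ∈ I :=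
    hNI (by simpa using div_le_of_le_mul (G := 2 ^ (n + 1)) (by positivity) (hi.trans hj))
  have hle : (↑(j / 2 * 2) / 2 ^ (n + 1) : ℝ≥0) ≤ j / 2 ^ (n + 1) := by
    gcongr
    exact Nat.div_mul_le_self j 2
  have hgap : (j / 2 ^ (n + 1) : ℝ≥0) - ↑(j / 2 * 2) / 2 ^ (n + 1) ≤ 1 / 2 ^ (n + 1) := by
    rw [tsub_le_iff_left, ← add_div]
    gcongr
    exact_mod_cast (by lia : j ≤ j / 2 * 2 + 1)
  convert hμ.measure_lt_abs_sub_le (hmem _ (Nat.div_mul_le_self j 2)) (hmem j le_rfl) hle hgap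
    (pow_nonneg hρ n) using 4
  push_cast
  rw [mul_pow, ← pow_mul, mul_comm 2 n, pow_mul]
  field_simp
  ring

theorem exists_measure_largeIncrementEvent_le {ρ : ℝ} (hρ : 0 ≤ ρ) (hρ' : 1 < 2 * ρ ^ 2) :
    ∃ C : ℝ, ∀ n, μ (largeIncrementEvent I N ρ n) ≤ ENNReal.ofReal C * 2⁻¹ ^ n := by
  obtain ⟨C, hC⟩ := exists_forall_card_mul_exp_neg_pow_le N hρ'
  refine ⟨C, fun n => ?_⟩
  have hgrid : {j | j ≤ (N + 1) * 2 ^ (n + 1)} = (Finset.Iic ((N + 1) * 2 ^ (n + 1)) : Set ℕ) := by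
    ext
    simp
  have hcount : ({j | j ≤ (N + 1) * 2 ^ (n + 1)}.encard : ℝ≥0∞) =
      ENNReal.ofReal ((N + 1) * 2 ^ (n + 1) + 1) := by
    rw [hgrid, Set.encard_coe_eq_coe_finsetCard, Nat.card_Iic, ENat.toENNReal_coe,
      ← ENNReal.ofReal_natCast]
    push_cast
    rfl
  calc μ (largeIncrementEvent I N ρ n)
      ≤ ENNReal.ofReal ((N + 1) * 2 ^ (n + 1) + 1) *
          ENNReal.ofReal (2 * Real.exp (-(2 * ρ ^ 2) ^ n)) := by
        rw [← hcount]
        exact measure_setOf_exists_le μ fun j hj => measure_pow_lt_abs_sub_pred_le hNI hμ hρ hj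
    _ = ENNReal.ofReal (((N + 1) * 2 ^ (n + 1) + 1) * (2 * Real.exp (-(2 * ρ ^ 2) ^ n))) :=
        (ENNReal.ofReal_mul (by positivity)).symm
    _ ≤ ENNReal.ofReal (C * 2⁻¹ ^ n) := ENNReal.ofReal_le_ofReal (hC n)
    _ = ENNReal.ofReal C * 2⁻¹ ^ n := by
        rw [ENNReal.ofReal_mul' (by positivity), ENNReal.ofReal_pow (by positivity),
          ENNReal.ofReal_inv_of_pos two_pos, ENNReal.ofReal_ofNat]

end Events

/-! ### Zeros of a random path -/

/-- The largest multiple of `2⁻ⁿ` which is at most `t`. -/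
def dyadicFloor (t : ℝ≥0) (n : ℕ) : ℝ≥0 :=
  ⌊t * 2 ^ n⌋₊ / 2 ^ n

theorem dyadicFloor_le (t : ℝ≥0) (n : ℕ) : dyadicFloor t n ≤ t :=
  div_le_of_le_mul₀ zero_le zero_le (Nat.floor_le zero_le)

theorem tendsto_dyadicFloor (t : ℝ≥0) : Tendsto (dyadicFloor t) atTop (nhds t) := by
  have hfloor (n : ℕ) : (dyadicFloor t n : ℝ) = ⌊(t : ℝ) * 2 ^ n⌋₊ / 2 ^ n := by
    have h : ⌊(t : ℝ) * 2 ^ n⌋₊ = ⌊t * 2 ^ n⌋₊ := Nonneg.nat_floor_coe (t * 2 ^ n)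
    simp [dyadicFloor, h]
  simp only [← NNReal.tendsto_coe, hfloor]
  exact (tendsto_nat_floor_mul_div_atTop t.2).comp (tendsto_pow_atTop_atTop_of_one_lt one_lt_two)

theorem floor_mul_two_pow_succ_div_two (t : ℝ≥0) (n : ℕ) :
    ⌊t * 2 ^ (n + 1)⌋₊ / 2 = ⌊t * 2 ^ n⌋₊ := by
  rw [← Nat.floor_div_natCast, pow_succ, ← mul_assoc, Nat.cast_ofNat,
    mul_div_cancel_right₀ _ two_ne_zero]

theorem floor_mul_two_pow_le {N : ℕ} {t : ℝ≥0} (ht : t ≤ N + 1) (n : ℕ) :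
    ⌊t * 2 ^ n⌋₊ ≤ (N + 1) * 2 ^ n := by
  refine Nat.floor_le_of_le ?_
  push_cast
  gcongr

theorem exists_eventually_two_pow_le_floor_mul {t : ℝ≥0} (ht : t ≠ 0) :
    ∃ R : ℕ, ∀ᶠ n in atTop, 2 ^ n ≤ ⌊t * 2 ^ n⌋₊ * R := by
  obtain ⟨R, hR⟩ := exists_nat_gt (t / 2)⁻¹
  refine ⟨R, ((tendsto_dyadicFloor t).eventually_const_lt (NNReal.half_lt_self ht)).mono
    fun n hn => ?_⟩
  have hone : 1 ≤ dyadicFloor t n * R := by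
    calc 1 = t / 2 * (t / 2)⁻¹ := (mul_inv_cancel₀ (by positivity)).symm
      _ ≤ dyadicFloor t n * R := by gcongr
  rw [dyadicFloor, div_mul_eq_mul_div, one_le_div (by positivity)] at hone
  exact_mod_cast hone

section Zeros

variable {I : Set ℝ≥0} {N : ℕ} {t : ℝ≥0}

theorem abs_pathVal_dyadicFloor_succ_sub_le (ht : t ≤ N + 1) {f : C(I, ℝ)} {ρ : ℝ} {n : ℕ}
    (hf : f ∉ largeIncrementEvent I N ρ n) :
    |pathVal f (dyadicFloor t (n + 1)) - pathVal f (dyadicFloor t n)| ≤ ρ ^ n := by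
  have hpred : dyadicFloor t n = ↑(⌊t * 2 ^ (n + 1)⌋₊ / 2 * 2) / 2 ^ (n + 1) := by
    rw [floor_mul_two_pow_succ_div_two, pow_succ, Nat.cast_mul, Nat.cast_ofNat,
      mul_div_mul_right _ _ two_ne_zero, dyadicFloor]
  rw [hpred]
  by_contra! hlt
  exact hf ⟨⌊t * 2 ^ (n + 1)⌋₊, floor_mul_two_pow_le ht _, hlt⟩

variable (hNI : Set.Iic ((N : ℝ≥0) + 1) ⊆ I) (ht : t ≤ N + 1)
include hNI ht

theorem tendsto_pathVal_dyadicFloor (f : C(I, ℝ)) :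
    Tendsto (fun n => pathVal f (dyadicFloor t n)) atTop (nhds (pathVal f t)) :=
  (continuousOn_pathVal f t (hNI ht)).tendsto.comp <|
    tendsto_nhdsWithin_iff.2 ⟨tendsto_dyadicFloor t,
      Eventually.of_forall fun n => hNI ((dyadicFloor_le t n).trans ht)⟩

theorem eventually_abs_pathVal_dyadicFloor_sub_le {f : C(I, ℝ)} {ρ : ℝ} (hρ : ρ < 1)
    (hf : ∀ᶠ n in atTop, f ∉ largeIncrementEvent I N ρ n) :
    ∀ᶠ n in atTop, |pathVal f (dyadicFloor t n) - pathVal f t| ≤ ρ ^ n / (1 - ρ) := by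
  refine (eventually_forall_ge_atTop.2 hf).mono fun n hn => ?_
  have hstep (l : ℕ) : dist (pathVal f (dyadicFloor t (n + l)))
      (pathVal f (dyadicFloor t (n + (l + 1)))) ≤ ρ ^ n * ρ ^ l := by
    rw [dist_comm, Real.dist_eq, ← pow_add]
    exact abs_pathVal_dyadicFloor_succ_sub_le ht (hn (n + l) (Nat.le_add_right n l))
  have hlim := (tendsto_pathVal_dyadicFloor hNI ht f).comp (tendsto_add_atTop_nat n)
  simp only [Function.comp_def, add_comm _ n] at hlim
  exact dist_le_of_le_geometric_of_tendsto₀ ρ (ρ ^ n) hρ hstep hlim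

end Zeros

theorem exists_nnrat_mul_lt_one {κ : ℝ≥0∞} (hκ : κ ^ 2 < 2) :
    ∃ ρ : ℚ≥0, (ρ : ℝ) < 1 ∧ 1 < 2 * (ρ : ℝ) ^ 2 ∧ κ * ENNReal.ofReal ρ < 1 := by
  lift κ to ℝ≥0 using by rintro rfl; simp at hκ
  have hκ' : (κ : ℝ) ^ 2 < 2 := by exact_mod_cast hκ
  have hmax : max (κ : ℝ) 1 < √2 :=
    max_lt (Real.lt_sqrt_of_sq_lt hκ') (Real.lt_sqrt_of_sq_lt (by norm_num))
  have hpos : 0 < max (κ : ℝ) 1 := by positivity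
  obtain ⟨q, hq, hq'⟩ := exists_rat_btwn (inv_strictAnti₀ hpos hmax)
  have hq₀ : (0 : ℝ) < q := lt_trans (by positivity) hq
  lift q to ℚ≥0 using by exact_mod_cast hq₀.le
  rw [Rat.cast_nnratCast] at hq hq' hq₀
  rw [lt_inv_comm₀ hq₀ hpos, max_lt_iff] at hq'
  have hκq : κ * (q : ℝ) < 1 := by
    rw [← lt_div_iff₀ hq₀, one_div]
    exact hq'.1
  refine ⟨q, ?_, ?_, ?_⟩
  · exact (one_lt_inv₀ hq₀).1 hq'.2
  · rw [inv_lt_comm₀ (by positivity) hq₀, Real.lt_sqrt (by positivity), inv_pow] at hq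
    rwa [← div_lt_iff₀ (by positivity), one_div]
  · rwa [← ENNReal.ofReal_coe_nnreal, ← ENNReal.ofReal_mul κ.coe_nonneg, ENNReal.ofReal_lt_one]

theorem IsMLRandom.eventually_not_floor {I : Set ℝ≥0} {N : ℕ}
    (hNI : Set.Iic ((N : ℝ≥0) + 1) ⊆ I) {μ : Measure C(I, ℝ)} (hμ : HasBrownianIncrements μ)
    {B : C(I, ℝ)} (hB : IsMLRandom μ B) {S : ℕ × ℕ → Prop} (hS : REPred S) {C κ : ℝ≥0∞}
    (hC : C ≠ ⊤) (hκ : κ ^ 2 < 2) (hcard : ∀ n, ({j | S (n, j)}.encard : ℝ≥0∞) ≤ C * κ ^ n)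
    {t : ℝ≥0} (ht₀ : t ≠ 0) (ht : t ≤ N + 1) (hBt : pathVal B t = 0) :
    ∀ᶠ n in atTop, ¬ S (n, ⌊t * 2 ^ n⌋₊) := by
  obtain ⟨ρ, hρ, hρ₂, hκρ⟩ := exists_nnrat_mul_lt_one hκ
  have hρ₀ : (0 : ℝ) < ρ := by
    contrapose! hρ₂
    simp [le_antisymm hρ₂ (NNRat.cast_nonneg ρ)]
  obtain ⟨R, hR⟩ := exists_eventually_two_pow_le_floor_mul ht₀
  obtain ⟨D, hD⟩ := exists_nat_gt (1 - (ρ : ℝ))⁻¹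
  obtain ⟨C', hC'⟩ := exists_measure_largeIncrementEvent_le hNI hμ hρ₀.le hρ₂
  have hincr := hB.eventually_notMem (effectivelyOpenFamily_largeIncrementEvent hNI ρ)
    ENNReal.ofReal_ne_top (ENNReal.inv_lt_one.2 ENNReal.one_lt_two) hC'
  have hsmall := hB.eventually_notMem (effectivelyOpenFamily_smallValueEvent hNI hS R D ρ)
    (by finiteness) hκρ fun n => measure_smallValueEvent_le hNI hμ R D hρ₀.le n (hcard n)
  filter_upwards [hR, hsmall, eventually_abs_pathVal_dyadicFloor_sub_le hNI ht hρ hincr]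
    with n hRn hsmall_n hclose hSn
  refine hsmall_n ⟨_, ⟨hSn, floor_mul_two_pow_le ht n, hRn⟩, ?_⟩
  calc |pathVal B (dyadicFloor t n)| ≤ ρ ^ n / (1 - ρ) := by simpa only [hBt, sub_zero] using hclose
    _ = (1 - (ρ : ℝ))⁻¹ * ρ ^ n := by rw [div_eq_inv_mul]
    _ < D * ρ ^ n := by gcongr

/-! ### Compressible initial segments -/

/-- The numerator of the dyadic rational with integer part `k` and binary digits `σ`. -/
def dyadicNumerator (k : ℕ) (σ : List Bool) : ℕ :=
  σ.foldl (fun j b => 2 * j + b.toNat) k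

theorem primrec_dyadicNumerator (k : ℕ) : Primrec (dyadicNumerator k) :=
  Primrec.list_foldl (h := fun _ (x : ℕ × Bool) => 2 * x.1 + x.2.toNat)
    Primrec.id (Primrec.const k) <|
    Primrec.nat_add.comp (Primrec.nat_mul.comp (Primrec.const 2) (Primrec.fst.comp Primrec.snd))
      ((Primrec.dom_bool Bool.toNat).comp (Primrec.snd.comp Primrec.snd))

theorem dyadicNumerator_binaryDigits (t : ℝ≥0) (n : ℕ) :
    dyadicNumerator ⌊t⌋₊ ((List.range n).map (binaryDigits t)) = ⌊t * 2 ^ n⌋₊ := by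
  induction n with
  | zero => simp [dyadicNumerator]
  | succ n ih =>
    have hfloor : ⌊(t : ℝ) * 2 ^ (n + 1)⌋ = ⌊t * 2 ^ (n + 1)⌋₊ :=
      (Int.natCast_floor_eq_floor (by positivity)).symm
    have hdigit : (binaryDigits t n).toNat = ⌊t * 2 ^ (n + 1)⌋₊ % 2 := by
      rw [binaryDigits, hfloor]
      norm_cast
      rcases Nat.mod_two_eq_zero_or_one ⌊t * 2 ^ (n + 1)⌋₊ with h | h <;> simp [h]
    have hstep : dyadicNumerator ⌊t⌋₊ ((List.range (n + 1)).map (binaryDigits t)) =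
        2 * ⌊t * 2 ^ n⌋₊ + (binaryDigits t n).toNat := by
      rw [← ih]
      simp [dyadicNumerator, List.range_succ]
    rw [hstep, hdigit, ← floor_mul_two_pow_succ_div_two, Nat.div_add_mod]

theorem encard_setOf_length_le (L : ℕ) : {p : List Bool | p.length ≤ L}.encard ≤ 2 ^ (L + 1) := by
  have hcard (l : ℕ) : {p : List Bool | p.length = l}.encard = 2 ^ l := by
    have h : {p : List Bool | p.length = l}.encard = ENat.card (List.Vector Bool l) := rfl
    simp [h, ENat.card_eq_coe_fintype_card]
  have hunion : {p : List Bool | p.length ≤ L} =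
      ⋃ l ∈ Finset.range (L + 1), {p | p.length = l} := by
    ext p
    simp
  calc {p : List Bool | p.length ≤ L}.encard ≤ ∑ l ∈ Finset.range (L + 1), 2 ^ l := by
        rw [hunion, ← Finset.sum_congr rfl fun l _ => hcard l]
        exact Finset.set_encard_biUnion_le _ _
    _ ≤ 2 ^ (L + 1) := by exact_mod_cast (Nat.geomSum_lt le_rfl (by simp)).le

/-- The relation saying that some number with binary representation of the form `k.σ`, where `σ`
has a program of length at most `a * n`, has the numerator `j` as a dyadic rational. -/
def HasShortProgram (U : List Bool →. List Bool) (k : ℕ) (a : ℚ≥0) (x : ℕ × ℕ) : Prop :=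
  ∃ p : List Bool, (p.length : ℚ≥0) ≤ a * x.1 ∧ ∃ σ ∈ U p, dyadicNumerator k σ = x.2

section HasShortProgram

variable {U : List Bool →. List Bool} (k : ℕ) (a : ℚ≥0)

theorem rePred_hasShortProgram (hU : Partrec U) : REPred (HasShortProgram U k a) := by
  have hlength : PrimrecPred fun y : (ℕ × ℕ) × List Bool =>
      y.2.length * a.den ≤ a.num * y.1.1 :=
    Primrec.nat_le.comp
      (Primrec.nat_mul.comp (Primrec.list_length.comp Primrec.snd) (Primrec.const a.den))
      (Primrec.nat_mul.comp (Primrec.const a.num) (Primrec.fst.comp Primrec.fst))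
  have houtput : PrimrecPred fun z : ((ℕ × ℕ) × List Bool) × List Bool =>
      dyadicNumerator k z.2 = z.1.1.2 :=
    Primrec.eq.comp ((primrec_dyadicNumerator k).comp Primrec.snd)
      (Primrec.snd.comp (Primrec.fst.comp Primrec.fst))
  refine (rePred_exists (rePred_and (rePred_of_primrecPred hlength)
    (rePred_bind (hU.comp Computable.snd) (rePred_of_primrecPred houtput)))).of_eq fun x => ?_
  have hiff (l : ℕ) : l * a.den ≤ a.num * x.1 ↔ (l : ℚ≥0) ≤ a * x.1 := by
    nth_rewrite 3 [← NNRat.num_div_den a]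
    rw [div_mul_eq_mul_div, le_div_iff₀ (by exact_mod_cast a.den_pos)]
    exact_mod_cast Iff.rfl
  simp only [hiff, HasShortProgram]

theorem encard_hasShortProgram_le (n : ℕ) :
    ({j | HasShortProgram U k a (n, j)}.encard : ℝ≥0∞) ≤ 2 * ((2 : ℝ≥0∞) ^ (a : ℝ)) ^ n := by
  choose! p hlength σ hσ hj using
    fun j (hj : HasShortProgram U k a (n, j)) => hj
  have hinj : Set.InjOn p {j | HasShortProgram U k a (n, j)} := fun i hi i' hi' hp => by
    have hσi : σ i = σ i' := Part.mem_unique (hσ i hi) (hp ▸ hσ i' hi')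
    exact (hj i hi).symm.trans (hσi ▸ hj i' hi')
  have hmaps : Set.MapsTo p {j | HasShortProgram U k a (n, j)}
      {q : List Bool | q.length ≤ ⌊a * n⌋₊} := fun j hj' => Nat.le_floor (hlength j hj')
  have hfloor : (⌊a * n⌋₊ : ℝ) ≤ a * n := by
    exact_mod_cast Nat.floor_le (zero_le (a := a * n))
  calc ({j | HasShortProgram U k a (n, j)}.encard : ℝ≥0∞) ≤ (2 ^ (⌊a * n⌋₊ + 1) : ℕ∞) :=
        ENat.toENNReal_le.2 ((Set.encard_le_encard_of_injOn hmaps hinj).trans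
          (encard_setOf_length_le _))
    _ = 2 * (2 : ℝ≥0∞) ^ (⌊a * n⌋₊ : ℝ) := by
        rw [ENNReal.rpow_natCast, ← pow_succ']
        simp
    _ ≤ 2 * (2 : ℝ≥0∞) ^ ((a : ℝ) * n) := by
        gcongr
        exact one_le_two
    _ = 2 * ((2 : ℝ≥0∞) ^ (a : ℝ)) ^ n := by rw [ENNReal.rpow_mul, ENNReal.rpow_natCast]

end HasShortProgram

theorem frequently_exists_short_program {U : List Bool →. List Bool} {X : ℕ → Bool} {a : ℚ≥0}
    (h : seqEffDim U X < (a : ℝ≥0)) :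
    ∃ᶠ n : ℕ in atTop, ∃ p : List Bool, (p.length : ℚ≥0) ≤ a * n ∧ (List.range n).map X ∈ U p := by
  refine ((frequently_lt_of_liminf_lt (by isBoundedDefault) h).and_eventually
    (eventually_ne_atTop 0)).mono ?_
  rintro n ⟨hn, hn₀⟩
  rw [ENNReal.div_lt_iff (by simp [hn₀]) (by simp), complexity] at hn
  simp only [ENat.toENNReal_iInf, iInf_lt_iff] at hn
  obtain ⟨p, hp, hlength⟩ := hn
  have hlength' : (p.length : ℝ≥0) ≤ a * n := ENNReal.coe_le_coe.1 (by simpa using hlength.le)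
  exact ⟨p, by exact_mod_cast hlength', hp⟩

theorem exists_nnrat_btwn {x y : ℝ≥0∞} (h : x < y) :
    ∃ q : ℚ≥0, x < (q : ℝ≥0) ∧ ((q : ℝ≥0) : ℝ≥0∞) < y := by
  obtain ⟨q, hq, hxq, hqy⟩ := ENNReal.lt_iff_exists_rat_btwn.1 h
  lift q to ℚ≥0 using hq
  have hcast : Real.toNNReal (q : ℚ) = (q : ℝ≥0) := by
    rw [Rat.cast_nnratCast, Real.toNNReal_of_nonneg (NNRat.cast_nonneg q)]
    rfl
  exact ⟨q, hcast ▸ hxq, hcast ▸ hqy⟩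

theorem two_rpow_sq_lt_two {x : ℝ≥0} (hx : (x : ℝ≥0∞) < 1 / 2) :
    ((2 : ℝ≥0∞) ^ (x : ℝ)) ^ 2 < 2 := by
  have hx' : (x : ℝ) * 2 < 1 := by
    rw [ENNReal.lt_div_iff_mul_lt (by simp) (by simp)] at hx
    exact_mod_cast hx
  calc ((2 : ℝ≥0∞) ^ (x : ℝ)) ^ 2 = 2 ^ ((x : ℝ) * 2) := by
        rw [ENNReal.rpow_mul, ENNReal.rpow_ofNat]
    _ < 2 ^ (1 : ℝ) :=
        ENNReal.rpow_lt_rpow_of_exponent_lt ENNReal.one_lt_two ENNReal.ofNat_ne_top hx'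
    _ = 2 := ENNReal.rpow_one 2

theorem exists_Iic_subset {I : Set ℝ≥0} (hI : I = Set.Icc 0 1 ∨ I = Set.univ) {t : ℝ≥0}
    (ht : t ∈ I) : ∃ N : ℕ, Set.Iic ((N : ℝ≥0) + 1) ⊆ I ∧ t ≤ N + 1 := by
  rcases hI with rfl | rfl
  · exact ⟨0, fun x hx => ⟨zero_le, by simpa using hx⟩, by simpa using ht.2⟩
  · exact ⟨⌊t⌋₊, Set.subset_univ _, (Nat.lt_floor_add_one t).le⟩

end MLBrownian

end

theorem mainTheorem2_general {I : Set ℝ≥0} {N : ℕ} (hNI : Set.Iic ((N : ℝ≥0) + 1) ⊆ I)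
    {μ : Measure C(I, ℝ)} (hμ : MLBrownian.HasBrownianIncrements μ) {U : List Bool →. List Bool}
    (hU : Partrec U) {B : C(I, ℝ)} (hB : MLBrownian.IsMLRandom μ B) :
    ∀ t ∈ MLBrownian.zeroSet B \ {0}, t ≤ N + 1 → (1 / 2 : ℝ≥0∞) ≤ MLBrownian.effDim U (t : ℝ) := by
  rintro t ⟨⟨htI, hBt⟩, ht₀⟩ ht
  by_contra! hlt
  obtain ⟨a, hdim, hhalf⟩ := MLBrownian.exists_nnrat_btwn hlt
  have hfloor := hB.eventually_not_floor hNI hμ (MLBrownian.rePred_hasShortProgram ⌊t⌋₊ a hU)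
    ENNReal.ofNat_ne_top (MLBrownian.two_rpow_sq_lt_two hhalf)
    (MLBrownian.encard_hasShortProgram_le ⌊t⌋₊ a) ht₀ ht
    ((MLBrownian.pathVal_of_mem B htI).trans hBt)
  obtain ⟨n, ⟨p, hlength, hp⟩, hn⟩ :=
    ((MLBrownian.frequently_exists_short_program hdim).and_eventually hfloor).exists
  exact hn ⟨p, hlength, _, hp, MLBrownian.dyadicNumerator_binaryDigits t n⟩

theorem mainTheorem2 (I : Set ℝ≥0) (hI : I = Set.Icc 0 1 ∨ I = Set.univ)
    (μ : Measure C(I, ℝ)) (hμ : MLBrownian.IsWienerMeasure μ)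
    (U : List Bool →. List Bool) (hU : MLBrownian.IsOptimalPrefixFreeMachine U)
    (B : C(I, ℝ)) (hB : MLBrownian.IsMLRandom μ B) :
    ∀ t ∈ MLBrownian.zeroSet B \ {0}, (1 / 2 : ℝ≥0∞) ≤ MLBrownian.effDim U (t : ℝ) := by
  intro t ht
  obtain ⟨N, hNI, htN⟩ := MLBrownian.exists_Iic_subset hI ht.1.1
  exact mainTheorem2_general hNI hμ.hasBrownianIncrements hU.partrec hB t ht htN
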